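/- Let $d\ge 1$ and $s\ge 0$ be integers, let $G\subset\mathbb{R}^d$ be a bounded set with Borel $\sigma$-algebra $\mathcal{B}(G)$, and let $\pi,\nu$ be probability measures on $(G,\mathcal{B}(G))$ such that $\nu$ has a density $\frac{d\nu}{d\pi}\in L_2=L_2(\pi)$. Let $K$ be a transition kernel on $(G,\mathcal{B}(G))$ that is reversible with respect to $\pi$, i.e. $\int_A K(x,B)\,\pi(dx)=\int_B K(x,A)\,\pi(dx)$ for all $A,B\in\mathcal{B}(G)$. Let $P f(x)=\int_G f(y)\,K(x,dy)$ be its Markov operator, let $L_2^0=\{f\in L_2:\int_G f\,d\pi=0\}$, and put $$\Lambda=\sup\{\lambda\in\operatorname{spec}(P\colon L_2^0\to L_2^0)\},\qquad \Lambda_0=\max\{\Lambda,0\}$$ (with $\Lambda_0=0$ if $L_2^0=\{0\}$). Assume that $K$ is variance bounding, i.e. $\Lambda<1$. Let $\varphi\colon G\times[0,1]^s\to G$ be any update function of $K$, i.e. a measurable function such that $K(x,A)=\lambda_s(\{u\in[0,1]^s:\varphi(x;u)\in A\})$ for all $x\in G$, $A\in\mathcal{B}(G)$, where $\lambda_s$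 is Lebesgue measure, and let $\psi\colon[0,1]^s\to G$ be any generator function of $\nu$, i.e. a measurable function such that $\nu(A)=\lambda_s(\{u\in[0,1]^s:\psi(u)\in A\})$ for all $A\in\mathcal{B}(G)$. For a driver sequence $u_0,\dots,u_{n-1}\in[0,1]^s$ let $S_n=(x_1,\dots,x_n)$ be given by $x_1=\psi(u_0)$ and $x_{i+1}=\varphi(x_i;u_i)$ for $i=1,\dots,n-1$. Let $\mathscr{B}=\{(-\infty,x)\cap G: x\in\mathbb{R}^d\}$ with $(-\infty,x)=\prod_{j=1}^d(-\infty,x_j)$, and let $$D^*_{\mathscr{B},\pi}(S_n)=\sup_{A\in\mathscr{B}}\Big|\frac1n\sum_{i=1}^n 1_{x_i\in A}-\pi(A)\Big|.$$ Then for every $n\ge 16$ there exists a driver sequence $u_0,\dots,u_{n-1}\in[0,1]^s$ such that $$D^*_{\mathscr{B},\pi}(S_n)\le\sqrt{\frac{1+\Lambda_0}{1-\Lambda_0}}\cdot\frac{\sqrt2\,\big(\log\|\frac{d\nu}{d\pi}\|_2+d\log n+3d^2\log(5d)\big)^{1/2}}{\sqrt n}+\frac{8}{n^{3/4}},$$ where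 $\|\cdot\|_2$ is the norm of $L_2(\pi)$. In particular, one can choose for each $n$ a driver sequence of length $n$ such that $D^*_{\mathscr{B},\pi}(S_n)=\mathcal{O}(n^{-1/2}(\log n)^{1/2})$ as $n\to\infty$. -/

import Mathlib

open MeasureTheory ProbabilityTheory
open scoped ENNReal

noncomputable section

namespace MCQMC

section MarkovOperator

variable {α : Type*} [MeasurableSpace α]

/-- The action of a kernel on functions: `(P f)(x) = ∫ f(y) K(x, dy)`. -/
def kernelAct (K : Kernel α α) (f : α → ℝ) : α → ℝ := fun x => ∫ y, f y ∂(K x)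

lemma lintegral_kernel {K : Kernel α α} {π : Measure α} (h : K.Invariant π)
    {g : α → ℝ≥0∞} (hg : Measurable g) :
    ∫⁻ x, ∫⁻ y, g y ∂(K x) ∂π = ∫⁻ x, g x ∂π := by
  conv_rhs => rw [← h.def]
  exact (Measure.lintegral_bind K.aemeasurable hg.aemeasurable).symm

lemma ae_kernel {K : Kernel α α} {π : Measure α} (h : K.Invariant π)
    {p : α → Prop} (hp : ∀ᵐ x ∂π, p x) : ∀ᵐ x ∂π, ∀ᵐ y ∂(K x), p y := by
  rw [← h.def] at hp
  exact Measure.ae_ae_of_ae_comp hp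

lemma kernelAct_congr {K : Kernel α α} {π : Measure α} (h : K.Invariant π)
    {f g : α → ℝ} (hfg : f =ᵐ[π] g) : kernelAct K f =ᵐ[π] kernelAct K g := by
  filter_upwards [ae_kernel h hfg] with x hx
  exact integral_congr_ae hx

lemma eLpNorm_two_sq (f : α → ℝ) (μ : Measure α) :
    eLpNorm f 2 μ ^ 2 = ∫⁻ x, ‖f x‖ₑ ^ 2 ∂μ := by
  have := eLpNorm_nnreal_pow_eq_lintegral (f := f) (μ := μ) (p := 2) (by norm_num)
  simpa using this

lemma eLpNorm_kernelAct_le {K : Kernel α α} [IsMarkovKernel K] {π : Measure α}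
    (h : K.Invariant π) {f : α → ℝ} (hf : StronglyMeasurable f) :
    eLpNorm (kernelAct K f) 2 π ≤ eLpNorm f 2 π := by
  have key : eLpNorm (kernelAct K f) 2 π ^ 2 ≤ eLpNorm f 2 π ^ 2 := by
    rw [eLpNorm_two_sq, eLpNorm_two_sq, ← lintegral_kernel h (hf.measurable.enorm.pow_const 2)]
    refine lintegral_mono fun x => ?_
    rw [← eLpNorm_two_sq]
    refine pow_le_pow_left' ?_ 2
    calc ‖kernelAct K f x‖ₑ ≤ ∫⁻ y, ‖f y‖ₑ ∂(K x) := enorm_integral_le_lintegral_enorm _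
      _ = eLpNorm f 1 (K x) := eLpNorm_one_eq_lintegral_enorm.symm
      _ ≤ eLpNorm f 2 (K x) :=
          eLpNorm_le_eLpNorm_of_exponent_le one_le_two hf.aestronglyMeasurable
  exact (ENNReal.pow_le_pow_left_iff two_ne_zero).1 key

lemma memLp_kernelAct {K : Kernel α α} [IsMarkovKernel K] {π : Measure α}
    (h : K.Invariant π) (f : Lp ℝ 2 π) : MemLp (kernelAct K f) 2 π :=
  ⟨(Lp.stronglyMeasurable f).integral_kernel.aestronglyMeasurable,
    (eLpNorm_kernelAct_le h (Lp.stronglyMeasurable f)).trans_lt (Lp.memLp f).2⟩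

lemma ae_integrable_kernel {K : Kernel α α} {π : Measure α} [IsFiniteMeasure π]
    (h : K.Invariant π) (f : Lp ℝ 2 π) : ∀ᵐ x ∂π, Integrable f (K x) := by
  have hf : Integrable f π := (Lp.memLp f).integrable one_le_two
  have h1 : ∫⁻ x, ∫⁻ y, ‖f y‖ₑ ∂(K x) ∂π ≠ ∞ := by
    rw [lintegral_kernel h (Lp.stronglyMeasurable f).measurable.enorm]
    exact hf.2.ne
  filter_upwards [ae_lt_top
    ((Lp.stronglyMeasurable f).measurable.enorm.lintegral_kernel (κ := K)) h1] with x hx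
  exact ⟨(Lp.stronglyMeasurable f).aestronglyMeasurable, hx⟩

/-- The Markov operator `P` of the kernel `K`, as a bounded operator on `L₂(π)`. -/
def markovOp (K : Kernel α α) [IsMarkovKernel K] (π : Measure α) [IsProbabilityMeasure π]
    (h : K.Invariant π) : Lp ℝ 2 π →L[ℝ] Lp ℝ 2 π :=
  LinearMap.mkContinuous
    { toFun := fun f => (memLp_kernelAct h f).toLp (kernelAct K f)
      map_add' := fun f g => by
        rw [← MemLp.toLp_add, MemLp.toLp_eq_toLp_iff]
        refine (kernelAct_congr h (Lp.coeFn_add f g)).trans ?_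
        filter_upwards [ae_integrable_kernel h f, ae_integrable_kernel h g] with x hf hg
        exact integral_add hf hg
      map_smul' := fun c f => by
        rw [RingHom.id_apply, ← MemLp.toLp_const_smul, MemLp.toLp_eq_toLp_iff]
        refine (kernelAct_congr h (Lp.coeFn_smul c f)).trans ?_
        exact Filter.Eventually.of_forall fun x => integral_const_mul c _ }
    1 (fun f => by
      rw [one_mul, Lp.norm_def, Lp.norm_def]
      refine ENNReal.toReal_mono (Lp.memLp f).2.ne ?_
      refine (eLpNorm_congr_ae (MemLp.coeFn_toLp (memLp_kernelAct h f))).trans_le ?_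
      exact eLpNorm_kernelAct_le h (Lp.stronglyMeasurable f))

lemma coeFn_markovOp (K : Kernel α α) [IsMarkovKernel K] (π : Measure α)
    [IsProbabilityMeasure π] (h : K.Invariant π) (f : Lp ℝ 2 π) :
    markovOp K π h f =ᵐ[π] fun x => ∫ y, f y ∂(K x) :=
  MemLp.coeFn_toLp (memLp_kernelAct h f)

/-- The subspace `L₂⁰(π)` of functions in `L₂(π)` with mean zero. -/
def L2Zero (π : Measure α) [IsProbabilityMeasure π] : Submodule ℝ (Lp ℝ 2 π) where
  carrier := {f | ∫ x, f x ∂π = 0}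
  zero_mem' := by
    simp only [Set.mem_ofPred_eq]
    rw [integral_congr_ae (Lp.coeFn_zero ℝ 2 π)]
    simp
  add_mem' := fun {f g} hf hg => by
    simp only [Set.mem_ofPred_eq] at hf hg ⊢
    rw [integral_congr_ae (Lp.coeFn_add f g)]
    have := integral_add ((Lp.memLp f).integrable one_le_two)
      ((Lp.memLp g).integrable one_le_two)
    simp only [Pi.add_apply]
    rw [this, hf, hg, add_zero]
  smul_mem' := fun c f hf => by
    simp only [Set.mem_ofPred_eq] at hf ⊢
    rw [integral_congr_ae (Lp.coeFn_smul c f)]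
    simp only [Pi.smul_apply]
    rw [integral_smul, hf, smul_zero]

lemma markovOp_mem_L2Zero {K : Kernel α α} [IsMarkovKernel K] {π : Measure α}
    [IsProbabilityMeasure π] (h : K.Invariant π) {f : Lp ℝ 2 π} (hf : f ∈ L2Zero π) :
    markovOp K π h f ∈ L2Zero π := by
  change ∫ x, markovOp K π h f x ∂π = 0
  change ∫ x, f x ∂π = 0 at hf
  rw [integral_congr_ae (coeFn_markovOp K π h f)]
  have hc : (K ∘ₖ Kernel.const Unit π) () = π := by
    rw [← Measure.comp_eq_comp_const_apply]
    exact h.def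
  have hi : Integrable f ((K ∘ₖ Kernel.const Unit π) ()) := by
    rw [hc]
    exact (Lp.memLp f).integrable one_le_two
  have := Kernel.integral_comp hi
  rw [hc, Kernel.const_apply] at this
  rw [← this, hf]

/-- The Markov operator restricted to mean-zero functions, `P : L₂⁰ → L₂⁰`. -/
def markovOpZero (K : Kernel α α) [IsMarkovKernel K] (π : Measure α) [IsProbabilityMeasure π]
    (h : K.Invariant π) : L2Zero π →L[ℝ] L2Zero π :=
  ((markovOp K π h).comp (L2Zero π).subtypeL).codRestrict (L2Zero π)
    (fun f => markovOp_mem_L2Zero h f.2)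

/-- `Λ = sup {λ ∈ spec(P | L₂⁰)}`. The spectrum is a bounded set of reals; it is empty only when
`L₂⁰ = {0}`, where the convention `sup ∅ = 0` still gives the intended `max(Λ, 0) = 0`. -/
def spectralSup (K : Kernel α α) [IsMarkovKernel K] (π : Measure α) [IsProbabilityMeasure π]
    (h : K.IsReversible π) : ℝ :=
  sSup (spectrum ℝ (markovOpZero K π h.invariant))

/-- A reversible kernel is variance bounding if `Λ < 1`. -/
def IsVarianceBounding (K : Kernel α α) [IsMarkovKernel K] (π : Measure α)
    [IsProbabilityMeasure π] (h : K.IsReversible π) : Prop :=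
  spectralSup K π h < 1

/-- `dν/dπ ∈ L₂(π)`: `ν` has a density with respect to `π`, and it is square integrable. -/
def HasL2Density (ν π : Measure α) : Prop :=
  ν ≪ π ∧ MemLp (fun x => (ν.rnDeriv π x).toReal) 2 π

/-- `‖dν/dπ‖₂`. -/
def densityNorm (ν π : Measure α) : ℝ :=
  (eLpNorm (fun x => (ν.rnDeriv π x).toReal) 2 π).toReal

end MarkovOperator

section Driver

/-- The cube `[0,1]^s`; its `volume` is the uniform distribution. -/
abbrev Cube (s : ℕ) : Type := Fin s → unitInterval

variable {α : Type*} [MeasurableSpace α] {s : ℕ}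

/-- `φ` is an update function of the kernel `K`: `K(x, A) = λ_s {u | φ(x; u) ∈ A}`. -/
def IsUpdateFunction (φ : α → Cube s → α) (K : Kernel α α) : Prop :=
  Measurable (Function.uncurry φ) ∧
    ∀ x A, MeasurableSet A → K x A = volume {u : Cube s | φ x u ∈ A}

/-- `ψ` is a generator function of `ν`: `ν(A) = λ_s {u | ψ(u) ∈ A}`. -/
def IsGeneratorFunction (ψ : Cube s → α) (ν : Measure α) : Prop :=
  Measurable ψ ∧ ∀ A, MeasurableSet A → ν A = volume {u : Cube s | ψ u ∈ A}

/-- `drivenState φ ψ u i _` is the state `x_{i+1}`: `x_1 = ψ(u_0)`, `x_{i+1} = φ(x_i; u_i)`. -/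
def drivenState (φ : α → Cube s → α) (ψ : Cube s → α) {n : ℕ} (u : Fin n → Cube s) :
    (i : ℕ) → i < n → α
  | 0, h => ψ (u ⟨0, h⟩)
  | i + 1, h => φ (drivenState φ ψ u i (Nat.lt_of_succ_lt h)) (u ⟨i + 1, h⟩)

/-- The points `S_n = (x_1, …, x_n)`, counted with multiplicity, generated by the driver sequence
`u_0, …, u_{n-1}`. -/
def drivenPoints (φ : α → Cube s → α) (ψ : Cube s → α) {n : ℕ} (u : Fin n → Cube s) :
    Fin n → α :=
  fun i => drivenState φ ψ u i i.isLt

/-- The star-discrepancy `sup_{A ∈ 𝒜} |(1/n) ∑ 1_{x_i ∈ A} - π(A)|`. -/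
def starDiscrepancy (𝒜 : Set (Set α)) (π : Measure α) {n : ℕ} (x : Fin n → α) : ℝ :=
  ⨆ A : 𝒜, |(1 / (n : ℝ)) * ∑ i, (A : Set α).indicator (fun _ => (1 : ℝ)) (x i)
    - π.real (A : Set α)|

/-- The boxes `(-∞, x) ∩ G`, `x ∈ ℝ^d`, as subsets of `G`. -/
def anchoredBoxes {d : ℕ} (G : Set (Fin d → ℝ)) : Set (Set G) :=
  {A | ∃ x : Fin d → ℝ, A = {y : G | ∀ j, (y : Fin d → ℝ) j < x j}}

end Driver

end MCQMC

end

/-!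
Reversibility makes `P` self-adjoint, so on `L₂⁰(π)` its quadratic form is at most `Λ₀ ‖·‖²`:
writing a function as its mean plus a centred part bounds `⟨w, P w⟩` by the square of the mean plus
`Λ₀` times the variance. Replacing `w²` by `w² exp(-h)` with
`h = t (f - ∫ f dπ) - t² / (2 (1 - Λ₀))` costs a covariance of `w` and `f`, which the spectral gap
absorbs; hence `⟨w, P w⟩ ≤ ∫ w² exp(-h) dπ`. By polarisation the tilted operator `w ↦ exp(h) P w` is
a contraction for the weighted norm `∫ w² exp(-h) dπ`. Iterating it computes `E exp(∑ h(x_i))` along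
the chain, so the Cauchy-Schwarz inequality against `dν/dπ` gives a Hoeffding inequality for the
chain. Finally, the anchored boxes lie between boxes built from quantiles of the coordinates,
finitely many in number, and a union bound over these produces a driver sequence for which no
deviation is large.
-/

namespace MCQMC

section Spectrum

variable {E : Type*} [NormedAddCommGroup E] [InnerProductSpace ℝ E]

lemma norm_mem_spectrum_of_isPositive [Nontrivial E] {S : E →L[ℝ] E}
    (hS : S.IsPositive) : ‖S‖ ∈ spectrum ℝ S := by
  by_contra hmem
  obtain ⟨ε, hε, hle⟩ := S.rayleighQuotient_le_of_norm_mem_resolventSet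
    (spectrum.mem_resolventSet_iff.2 (spectrum.notMem_iff.1 hmem))
  have habs : ∀ x, |S.rayleighQuotient x| ≤ ‖S‖ - ε := fun x =>
    (abs_of_nonneg (div_nonneg (hS.2 x) (sq_nonneg _))).trans_le (hle x)
  have hsup := S.norm_eq_iSup_rayleighQuotient hS.isSymmetric
  linarith [ciSup_le habs]

theorem inner_le_sSup_spectrum [CompleteSpace E] {T : E →L[ℝ] E} (hT : T.IsSymmetric) (x : E) :
    inner ℝ (T x) x ≤ sSup (spectrum ℝ T) * ‖x‖ ^ 2 := by
  rcases subsingleton_or_nontrivial E with _ | _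
  · simp [Subsingleton.elim x 0]
  set S : E →L[ℝ] E := algebraMap ℝ (E →L[ℝ] E) ‖T‖ + T with hS
  have inner_S : ∀ y, inner ℝ (S y) y = ‖T‖ * ‖y‖ ^ 2 + inner ℝ (T y) y := fun y => by
    simp [hS, inner_add_left, ContinuousLinearMap.algebraMap_apply, real_inner_smul_left]
  have hpos : S.IsPositive := by
    refine ⟨fun y z => ?_, fun y => ?_⟩
    · have := hT y z
      simp_all [inner_add_left, inner_add_right, ContinuousLinearMap.algebraMap_apply,
        real_inner_smul_left, real_inner_smul_right]
    · have h1 := (abs_le.1 (abs_real_inner_le_norm (T y) y)).1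
      have h2 := mul_le_mul_of_nonneg_right (T.le_opNorm y) (norm_nonneg y)
      change 0 ≤ inner ℝ (S y) y
      rw [inner_S]
      nlinarith
  have hmem : ‖S‖ - ‖T‖ ∈ spectrum ℝ T := by
    rw [← spectrum.add_mem_add_iff (s := ‖T‖), sub_add_cancel]
    exact norm_mem_spectrum_of_isPositive hpos
  have hbdd : BddAbove (spectrum ℝ T) := (spectrum.isBounded T).bddAbove
  calc inner ℝ (T x) x = inner ℝ (S x) x - ‖T‖ * ‖x‖ ^ 2 := by rw [inner_S]; ring
    _ ≤ ‖S‖ * ‖x‖ ^ 2 - ‖T‖ * ‖x‖ ^ 2 := by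
        have h1 := real_inner_le_norm (S x) x
        have h2 := mul_le_mul_of_nonneg_right (S.le_opNorm x) (norm_nonneg x)
        nlinarith
    _ = (‖S‖ - ‖T‖) * ‖x‖ ^ 2 := by ring
    _ ≤ sSup (spectrum ℝ T) * ‖x‖ ^ 2 := by gcongr; exact le_csSup hbdd hmem

end Spectrum

section LpPairing

variable {α : Type*} [MeasurableSpace α] {μ : Measure α} {u w : α → ℝ}

lemma inner_toLp_toLp (hu : MemLp u 2 μ) (hw : MemLp w 2 μ) :
    inner ℝ (hu.toLp u) (hw.toLp w) = ∫ x, u x * w x ∂μ := by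
  rw [L2.inner_def]
  refine integral_congr_ae ?_
  filter_upwards [hu.coeFn_toLp, hw.coeFn_toLp] with x hux hwx
  rw [hux, hwx, RCLike.inner_apply, conj_trivial, mul_comm]

lemma norm_toLp_sq (hw : MemLp w 2 μ) : ‖hw.toLp w‖ ^ 2 = ∫ x, w x ^ 2 ∂μ := by
  rw [← real_inner_self_eq_norm_sq, inner_toLp_toLp]
  simp only [sq]

end LpPairing

section CompProd

lemma integral_comp_of_measurePreserving {α β : Type*} [MeasurableSpace α] [MeasurableSpace β]
    {μ : Measure α} {ν : Measure β} {f : α → β} (hf : MeasurePreserving f μ ν) {g : β → ℝ}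
    (hg : AEStronglyMeasurable g ν) : ∫ x, g (f x) ∂μ = ∫ y, g y ∂ν := by
  rw [← hf.map_eq] at hg ⊢
  exact (integral_map hf.aemeasurable hg).symm

variable {α : Type*} [MeasurableSpace α] {K : Kernel α α} [IsMarkovKernel K] {π : Measure α}
  {u w : α → ℝ}

lemma memLp_kernelAct_of_memLp (hK : K.Invariant π) (hw : MemLp w 2 π) :
    MemLp (kernelAct K w) 2 π :=
  (memLp_kernelAct hK (hw.toLp w)).ae_eq (kernelAct_congr hK hw.coeFn_toLp)

variable [IsFiniteMeasure π]

lemma measurePreserving_fst_compProd : MeasurePreserving Prod.fst (π ⊗ₘ K) π :=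
  ⟨measurable_fst, Measure.fst_compProd π K⟩

lemma measurePreserving_snd_compProd (hK : K.Invariant π) :
    MeasurePreserving Prod.snd (π ⊗ₘ K) π :=
  ⟨measurable_snd, (Measure.snd_compProd π K).trans hK.def⟩

lemma measurePreserving_swap_compProd (hK : K.IsReversible π) :
    MeasurePreserving Prod.swap (π ⊗ₘ K) (π ⊗ₘ K) := by
  refine ⟨measurable_swap, Measure.ext_prod_iff.2 fun {s t} hs ht => ?_⟩
  rw [Measure.map_apply measurable_swap (hs.prod ht), Set.preimage_swap_prod,
    Measure.compProd_apply_prod ht hs, Measure.compProd_apply_prod hs ht]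
  exact hK ht hs

lemma memLp_comp_fst_compProd (hw : MemLp w 2 π) : MemLp (fun z => w z.1) 2 (π ⊗ₘ K) :=
  hw.comp_measurePreserving measurePreserving_fst_compProd

lemma memLp_comp_snd_compProd (hK : K.Invariant π) (hw : MemLp w 2 π) :
    MemLp (fun z => w z.2) 2 (π ⊗ₘ K) :=
  hw.comp_measurePreserving (measurePreserving_snd_compProd hK)

lemma integrable_mul_compProd (hK : K.Invariant π) (hu : MemLp u 2 π) (hw : MemLp w 2 π) :
    Integrable (fun z : α × α => u z.1 * w z.2) (π ⊗ₘ K) :=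
  (memLp_comp_fst_compProd hu).integrable_mul (memLp_comp_snd_compProd hK hw)

lemma integral_mul_kernelAct (hK : K.Invariant π) (hu : MemLp u 2 π) (hw : MemLp w 2 π) :
    ∫ x, u x * kernelAct K w x ∂π = ∫ z, u z.1 * w z.2 ∂(π ⊗ₘ K) := by
  rw [Measure.integral_compProd (integrable_mul_compProd hK hu hw)]
  simp only [kernelAct, integral_const_mul]

lemma integral_mul_kernelAct_comm (hK : K.IsReversible π) (hu : MemLp u 2 π)
    (hw : MemLp w 2 π) :
    ∫ x, u x * kernelAct K w x ∂π = ∫ x, w x * kernelAct K u x ∂π := by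
  rw [integral_mul_kernelAct hK.invariant hu hw, integral_mul_kernelAct hK.invariant hw hu,
    ← (measurePreserving_swap_compProd hK).integral_comp
      MeasurableEquiv.prodComm.measurableEmbedding]
  simp only [Prod.fst_swap, Prod.snd_swap, mul_comm]

end CompProd

section Reversible

variable {α : Type*} [MeasurableSpace α] {K : Kernel α α} [IsMarkovKernel K] {π : Measure α}
  [IsProbabilityMeasure π] {u w : α → ℝ}

lemma markovOp_toLp (hK : K.Invariant π) (hw : MemLp w 2 π) :
    markovOp K π hK (hw.toLp w) = (memLp_kernelAct_of_memLp hK hw).toLp (kernelAct K w) :=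
  (MemLp.toLp_eq_toLp_iff (memLp_kernelAct hK _) _).2 (kernelAct_congr hK hw.coeFn_toLp)

lemma inner_toLp_markovOp_toLp (hK : K.Invariant π) (hu : MemLp u 2 π) (hw : MemLp w 2 π) :
    inner ℝ (hu.toLp u) (markovOp K π hK (hw.toLp w)) = ∫ x, u x * kernelAct K w x ∂π := by
  rw [markovOp_toLp, inner_toLp_toLp]

lemma isClosed_L2Zero : IsClosed (L2Zero π : Set (Lp ℝ 2 π)) := by
  have hker : (L2Zero π : Set (Lp ℝ 2 π)) = (fun f : Lp ℝ 2 π =>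
      inner ℝ (indicatorConstLp 2 MeasurableSet.univ (measure_ne_top π _) (1 : ℝ)) f) ⁻¹' {0} := by
    ext f
    simp only [Set.mem_preimage, Set.mem_singleton_iff, L2.inner_indicatorConstLp_one,
      setIntegral_univ]
    rfl
  exact hker ▸ isClosed_singleton.preimage (by fun_prop)

lemma isSymmetric_markovOpZero (hK : K.IsReversible π) :
    (markovOpZero K π hK.invariant).IsSymmetric := by
  intro f g
  change inner ℝ (markovOp K π hK.invariant f) (g : Lp ℝ 2 π) =
    inner ℝ (f : Lp ℝ 2 π) (markovOp K π hK.invariant g)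
  have hf := Lp.memLp (f : Lp ℝ 2 π)
  have hg := Lp.memLp (g : Lp ℝ 2 π)
  rw [real_inner_comm, ← Lp.toLp_coeFn (f : Lp ℝ 2 π) hf, ← Lp.toLp_coeFn (g : Lp ℝ 2 π) hg,
    inner_toLp_markovOp_toLp hK.invariant hg hf, inner_toLp_markovOp_toLp hK.invariant hf hg,
    integral_mul_kernelAct_comm hK hg hf]

lemma integral_mul_kernelAct_le_of_integral_eq_zero (hK : K.IsReversible π)
    (hw : MemLp w 2 π) (hw0 : ∫ x, w x ∂π = 0) :
    ∫ x, w x * kernelAct K w x ∂π ≤ spectralSup K π hK * ∫ x, w x ^ 2 ∂π := by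
  have : CompleteSpace (L2Zero π) := isClosed_L2Zero.completeSpace_coe
  have hmem : hw.toLp w ∈ L2Zero π := (integral_congr_ae hw.coeFn_toLp).trans hw0
  rw [← inner_toLp_markovOp_toLp hK.invariant hw hw, ← norm_toLp_sq hw, real_inner_comm]
  exact inner_le_sSup_spectrum (isSymmetric_markovOpZero hK) ⟨hw.toLp w, hmem⟩

theorem integral_mul_kernelAct_le (hK : K.IsReversible π) (hw : MemLp w 2 π) :
    ∫ x, w x * kernelAct K w x ∂π ≤
      (∫ x, w x ∂π) ^ 2 + spectralSup K π hK * Var[w; π] := by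
  set m := ∫ x, w x ∂π with hm
  have hw1 : Integrable w π := hw.integrable one_le_two
  have hv : MemLp (fun x => w x - m) 2 π := hw.sub (memLp_const m)
  have hv0 : ∫ x, (w x - m) ∂π = 0 := by
    simpa only [average_eq_integral] using integral_sub_average π w
  have hfst : ∫ z, w z.1 ∂(π ⊗ₘ K) = m :=
    integral_comp_of_measurePreserving measurePreserving_fst_compProd hw1.1
  have hsnd : ∫ z, w z.2 ∂(π ⊗ₘ K) = m :=
    integral_comp_of_measurePreserving (measurePreserving_snd_compProd hK.invariant) hw1.1
  have hcov : ∫ x, (w x - m) * kernelAct K (fun y => w y - m) x ∂π =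
      ∫ x, w x * kernelAct K w x ∂π - m ^ 2 := by
    have hsub := covariance_eq_sub (memLp_comp_fst_compProd (K := K) hw)
      (memLp_comp_snd_compProd hK.invariant hw)
    rw [covariance, hfst, hsnd] at hsub
    rw [integral_mul_kernelAct hK.invariant hv hv, integral_mul_kernelAct hK.invariant hw hw, hsub,
      sq]
    rfl
  rw [variance_eq_integral hw1.aemeasurable, ← hm]
  linarith [integral_mul_kernelAct_le_of_integral_eq_zero hK hv hv0]

end Reversible

section BoundedMeasurable

variable {α β : Type*} [MeasurableSpace α] [MeasurableSpace β]

/-- The algebra of bounded measurable real functions on `α`. Boundedness is everywhere rather than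
almost everywhere, so that no exceptional sets have to be tracked along the paths of a chain. -/
def boundedMeasurable (α : Type*) [MeasurableSpace α] : Subalgebra ℝ (α → ℝ) where
  carrier := {f | Measurable f ∧ ∃ C, ∀ x, |f x| ≤ C}
  mul_mem' := by
    rintro f g ⟨hf, C, hC⟩ ⟨hg, D, hD⟩
    refine ⟨hf.mul hg, C * D, fun x => ?_⟩
    rw [Pi.mul_apply, abs_mul]
    exact mul_le_mul (hC x) (hD x) (abs_nonneg _) ((abs_nonneg _).trans (hC x))
  add_mem' := by
    rintro f g ⟨hf, C, hC⟩ ⟨hg, D, hD⟩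
    exact ⟨hf.add hg, C + D, fun x => (abs_add_le _ _).trans (add_le_add (hC x) (hD x))⟩
  algebraMap_mem' c := ⟨measurable_const, |c|, fun _ => le_rfl⟩

variable {f w : α → ℝ}

lemma mem_boundedMeasurable_of_mem_Icc {a b : ℝ} (hf : Measurable f)
    (hfab : ∀ x, f x ∈ Set.Icc a b) : f ∈ boundedMeasurable α :=
  ⟨hf, max |a| |b|, fun x => abs_le_max_abs_abs (hfab x).1 (hfab x).2⟩

lemma comp_mem_boundedMeasurable {F : β → α} (hf : f ∈ boundedMeasurable α) (hF : Measurable F) :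
    (fun y => f (F y)) ∈ boundedMeasurable β :=
  ⟨hf.1.comp hF, hf.2.imp fun _ hC y => hC (F y)⟩

lemma exp_mem_boundedMeasurable (hf : f ∈ boundedMeasurable α) :
    (fun x => Real.exp (f x)) ∈ boundedMeasurable α := by
  obtain ⟨hmeas, C, hC⟩ := hf
  refine mem_boundedMeasurable_of_mem_Icc (a := 0) (b := Real.exp C) hmeas.exp fun x => ?_
  exact ⟨(Real.exp_pos _).le, Real.exp_le_exp.2 (abs_le.1 (hC x)).2⟩

lemma kernelAct_mem_boundedMeasurable {K : Kernel α α} [IsMarkovKernel K]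
    (hf : f ∈ boundedMeasurable α) : kernelAct K f ∈ boundedMeasurable α := by
  obtain ⟨hmeas, C, hC⟩ := hf
  refine ⟨hmeas.stronglyMeasurable.integral_kernel.measurable, C, fun x => ?_⟩
  have hle := norm_integral_le_of_norm_le_const (μ := K x) (f := f) (.of_forall hC)
  rwa [probReal_univ, mul_one] at hle

variable {μ : Measure α}

lemma memLp_of_mem_boundedMeasurable [IsFiniteMeasure μ] (hf : f ∈ boundedMeasurable α)
    (p : ℝ≥0∞) : MemLp f p μ :=
  MemLp.of_bound hf.1.aestronglyMeasurable _ (.of_forall hf.2.choose_spec)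

lemma integrable_of_mem_boundedMeasurable [IsFiniteMeasure μ] (hf : f ∈ boundedMeasurable α) :
    Integrable f μ :=
  memLp_one_iff_integrable.1 (memLp_of_mem_boundedMeasurable hf 1)

lemma integrable_mul_of_mem_boundedMeasurable (hw : Integrable w μ)
    (hf : f ∈ boundedMeasurable α) : Integrable (fun x => w x * f x) μ :=
  hw.mul_bdd hf.1.aestronglyMeasurable (.of_forall hf.2.choose_spec)

lemma memLp_mul_of_mem_boundedMeasurable {p : ℝ≥0∞} (hw : MemLp w p μ)
    (hf : f ∈ boundedMeasurable α) : MemLp (fun x => f x * w x) p μ := by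
  obtain ⟨hmeas, C, hC⟩ := hf
  refine hw.of_le_mul (c := C) (hmeas.aestronglyMeasurable.mul hw.1) (.of_forall fun x => ?_)
  rw [norm_mul]
  gcongr
  exact hC x

end BoundedMeasurable

section VariancePerturbation

variable {α : Type*} [MeasurableSpace α] {π : Measure α} [IsProbabilityMeasure π] {f w : α → ℝ}

lemma integral_sq_eq_sq_add_variance (hw : MemLp w 2 π) :
    ∫ x, w x ^ 2 ∂π = (∫ x, w x ∂π) ^ 2 + Var[w; π] := by
  rw [variance_eq_sub hw]
  simp only [Pi.pow_apply, add_sub_cancel]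

lemma mul_add_sq_mul_le {a t r : ℝ} (ha : 0 < a) (ht : 0 ≤ t) (hr : r ≤ 1) (m v : ℝ) :
    t * ((m + v) ^ 2 * r) ≤
      t * m ^ 2 * r + 2 * t ^ 2 / a * m ^ 2 * r ^ 2 + (a / 2 + t) * v ^ 2 := by
  -- Young's inequality for the cross term `2 t m v r`.
  have hcross : 0 ≤ a / 2 * (v - 2 * t / a * m * r) ^ 2 := by positivity
  have hexpand : a / 2 * (v - 2 * t / a * m * r) ^ 2 =
      a / 2 * v ^ 2 - 2 * t * m * v * r + 2 * t ^ 2 / a * m ^ 2 * r ^ 2 := by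
    field_simp
    ring
  have hlast : t * v ^ 2 * r ≤ t * v ^ 2 * 1 := by gcongr
  linarith

lemma mul_integral_sq_mul_le (hf : f ∈ boundedMeasurable α) (hf1 : ∀ x, f x ≤ 1)
    (hf0 : ∫ x, f x ∂π = 0) (hw : MemLp w 2 π) {a t : ℝ} (ha : 0 < a) (ht : 0 ≤ t) :
    t * ∫ x, w x ^ 2 * f x ∂π ≤
      2 * t ^ 2 / a * (∫ x, w x ∂π) ^ 2 * Var[f; π] + (a / 2 + t) * Var[w; π] := by
  set m := ∫ x, w x ∂π
  have hif := integrable_of_mem_boundedMeasurable (μ := π) hf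
  have hif2 := (memLp_of_mem_boundedMeasurable (μ := π) hf 2).integrable_sq
  have hiv2 : Integrable (fun x => (w x - m) ^ 2) π := (hw.sub (memLp_const m)).integrable_sq
  calc t * ∫ x, w x ^ 2 * f x ∂π = ∫ x, t * (w x ^ 2 * f x) ∂π := (integral_const_mul _ _).symm
    _ ≤ ∫ x, (t * m ^ 2 * f x + 2 * t ^ 2 / a * m ^ 2 * f x ^ 2 +
          (a / 2 + t) * (w x - m) ^ 2) ∂π := by
        have hiwf := (integrable_mul_of_mem_boundedMeasurable hw.integrable_sq hf).const_mul t
        refine integral_mono hiwf (by fun_prop) fun x => ?_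
        simpa only [add_sub_cancel] using mul_add_sq_mul_le ha ht (hf1 x) m (w x - m)
    _ = 2 * t ^ 2 / a * m ^ 2 * Var[f; π] + (a / 2 + t) * Var[w; π] := by
        rw [integral_add (by fun_prop) (by fun_prop), integral_add (by fun_prop) (by fun_prop),
          integral_const_mul, integral_const_mul, integral_const_mul, hf0, mul_zero, zero_add,
          variance_of_integral_eq_zero hif.aemeasurable hf0, variance_eq_integral hw.1.aemeasurable]

lemma mul_integral_sq_mul_centered_le (hf : Measurable f) (hf01 : ∀ x, f x ∈ Set.Icc 0 1)
    (hw : MemLp w 2 π) {a t : ℝ} (ha : 0 < a) (ht : 0 ≤ t) :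
    t * ∫ x, w x ^ 2 * (f x - ∫ y, f y ∂π) ∂π ≤
      t ^ 2 / (2 * a) * ∫ x, w x ^ 2 ∂π + a * Var[w; π] := by
  have hμ : 0 ≤ ∫ y, f y ∂π := integral_nonneg fun x => (hf01 x).1
  have hmem : (fun x => f x - ∫ y, f y ∂π) ∈ boundedMeasurable α :=
    sub_mem (mem_boundedMeasurable_of_mem_Icc hf hf01) (Subalgebra.algebraMap_mem _ _)
  have hvar : Var[fun x => f x - ∫ y, f y ∂π; π] ≤ 1 / 4 := by
    rw [variance_sub_const hf.aestronglyMeasurable]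
    exact (variance_le_sq_of_bounded (.of_forall hf01) hf.aemeasurable).trans_eq (by norm_num)
  have hamgm : t ≤ t ^ 2 / (2 * a) + a / 2 := by
    have hsq : 0 ≤ (t - a) ^ 2 / (2 * a) := by positivity
    have hexpand : (t - a) ^ 2 / (2 * a) = t ^ 2 / (2 * a) + a / 2 - t := by field_simp; ring
    linarith
  calc t * ∫ x, w x ^ 2 * (f x - ∫ y, f y ∂π) ∂π
      ≤ 2 * t ^ 2 / a * (∫ x, w x ∂π) ^ 2 * Var[fun x => f x - ∫ y, f y ∂π; π] +
          (a / 2 + t) * Var[w; π] :=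
        mul_integral_sq_mul_le hmem (fun x => by linarith [(hf01 x).2])
          (by simpa only [average_eq_integral] using integral_sub_average π f) hw ha ht
    _ ≤ 2 * t ^ 2 / a * (∫ x, w x ∂π) ^ 2 * (1 / 4) +
          (a / 2 + (t ^ 2 / (2 * a) + a / 2)) * Var[w; π] := by
        have := variance_nonneg w π
        gcongr
    _ = t ^ 2 / (2 * a) * ∫ x, w x ^ 2 ∂π + a * Var[w; π] := by
        rw [integral_sq_eq_sq_add_variance hw]
        ring

lemma integral_mul_kernelAct_le_integral_sq_mul_exp {K : Kernel α α} [IsMarkovKernel K]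
    (hK : K.IsReversible π) {Λ : ℝ} (hspec : spectralSup K π hK ≤ Λ) (hΛ : Λ < 1)
    (hf : Measurable f) (hf01 : ∀ x, f x ∈ Set.Icc 0 1) {t : ℝ} (ht : 0 ≤ t)
    (hw : MemLp w 2 π) :
    ∫ x, w x * kernelAct K w x ∂π ≤
      ∫ x, w x ^ 2 * Real.exp (-(t * (f x - ∫ y, f y ∂π) - t ^ 2 / (2 * (1 - Λ)))) ∂π := by
  set F := fun x => f x - ∫ y, f y ∂π
  set S := t ^ 2 / (2 * (1 - Λ))
  have hF : F ∈ boundedMeasurable α :=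
    sub_mem (mem_boundedMeasurable_of_mem_Icc hf hf01) (Subalgebra.algebraMap_mem _ _)
  have hlin : (fun x => 1 + S - t * F x) ∈ boundedMeasurable α :=
    sub_mem (Subalgebra.algebraMap_mem _ _) (Subalgebra.smul_mem _ hF t)
  have hexp : (fun x => Real.exp (-(t * F x - S))) ∈ boundedMeasurable α :=
    exp_mem_boundedMeasurable
      (neg_mem (sub_mem (Subalgebra.smul_mem _ hF t) (Subalgebra.algebraMap_mem _ _)))
  have hw2 := hw.integrable_sq
  have hwF := integrable_mul_of_mem_boundedMeasurable hw2 hF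
  calc ∫ x, w x * kernelAct K w x ∂π
      ≤ (∫ x, w x ∂π) ^ 2 + spectralSup K π hK * Var[w; π] := integral_mul_kernelAct_le hK hw
    _ ≤ (∫ x, w x ∂π) ^ 2 + Λ * Var[w; π] := by
        have := variance_nonneg w π
        gcongr
    _ = ∫ x, w x ^ 2 ∂π - (1 - Λ) * Var[w; π] := by
        rw [integral_sq_eq_sq_add_variance hw]
        ring
    _ ≤ (1 + S) * ∫ x, w x ^ 2 ∂π - t * ∫ x, w x ^ 2 * F x ∂π := by
        linarith [mul_integral_sq_mul_centered_le hf hf01 hw (sub_pos.2 hΛ) ht]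
    _ = ∫ x, w x ^ 2 * (1 + S - t * F x) ∂π := by
        rw [← integral_const_mul, ← integral_const_mul,
          ← integral_sub (hw2.const_mul _) (hwF.const_mul _)]
        exact integral_congr_ae (.of_forall fun x => by ring)
    _ ≤ ∫ x, w x ^ 2 * Real.exp (-(t * F x - S)) ∂π := by
        refine integral_mono (integrable_mul_of_mem_boundedMeasurable hw2 hlin)
          (integrable_mul_of_mem_boundedMeasurable hw2 hexp) fun x => ?_
        gcongr
        linarith [Real.add_one_le_exp (-(t * F x - S))]

end VariancePerturbation

section TiltedOperator

variable {α : Type*} [MeasurableSpace α] {π : Measure α}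
  {K : Kernel α α} [IsMarkovKernel K] {h u w : α → ℝ}

/-- The Feynman–Kac operator `e^h P`: its powers compute the exponential moments of the additive
functional `∑ h(x_i)` of the chain with transition operator `P`. -/
noncomputable def tiltedAct (K : Kernel α α) (h w : α → ℝ) : α → ℝ :=
  fun x => Real.exp (h x) * kernelAct K w x

lemma memLp_tiltedAct (hK : K.Invariant π) (hh : h ∈ boundedMeasurable α) (hw : MemLp w 2 π) :
    MemLp (tiltedAct K h w) 2 π :=
  memLp_mul_of_mem_boundedMeasurable (memLp_kernelAct_of_memLp hK hw) (exp_mem_boundedMeasurable hh)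

lemma tiltedAct_mem_boundedMeasurable (hh : h ∈ boundedMeasurable α)
    (hw : w ∈ boundedMeasurable α) : tiltedAct K h w ∈ boundedMeasurable α :=
  mul_mem (exp_mem_boundedMeasurable hh) (kernelAct_mem_boundedMeasurable hw)

lemma mul_add_mul_le_sqrt_mul_sqrt (a b c d : ℝ) :
    a * d + b * c ≤ √(a ^ 2 + b ^ 2) * √(c ^ 2 + d ^ 2) := by
  rw [← Real.sqrt_mul (by positivity)]
  exact Real.le_sqrt_of_sq_le (by linarith [sq_nonneg (a * c - b * d)])

lemma memLp_sqrt_sq_add_sq (hu : MemLp u 2 π) (hw : MemLp w 2 π) :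
    MemLp (fun x => √(u x ^ 2 + w x ^ 2)) 2 π := by
  refine (hu.norm.add hw.norm).mono'
    (((hu.1.pow 2).add (hw.1.pow 2)).aemeasurable.sqrt.aestronglyMeasurable)
    (.of_forall fun x => ?_)
  rw [Real.norm_of_nonneg (Real.sqrt_nonneg _), ← sq_abs (u x), ← sq_abs (w x)]
  exact Real.sqrt_le_iff.2 ⟨add_nonneg (norm_nonneg _) (norm_nonneg _), by
    simp only [Real.norm_eq_abs, Pi.add_apply]
    nlinarith [abs_nonneg (u x), abs_nonneg (w x)]⟩

variable [IsFiniteMeasure π]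

theorem two_mul_integral_mul_kernelAct_le (hK : K.IsReversible π) {r : α → ℝ}
    (hr : r ∈ boundedMeasurable α)
    (hform : ∀ w : α → ℝ, MemLp w 2 π →
      ∫ x, w x * kernelAct K w x ∂π ≤ ∫ x, w x ^ 2 * r x ∂π)
    (hu : MemLp u 2 π) (hw : MemLp w 2 π) :
    2 * ∫ x, u x * kernelAct K w x ∂π ≤ ∫ x, u x ^ 2 * r x ∂π + ∫ x, w x ^ 2 * r x ∂π := by
  -- Polarising with `u + w` and `u - w` would also need a lower bound on the form. Testing it with
  -- `√(u² + w²)` needs the upper bound only, because `P` preserves positivity.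
  have hs := memLp_sqrt_sq_add_sq hu hw
  have huw := integrable_mul_compProd hK.invariant hu hw
  have hwu := integrable_mul_compProd hK.invariant hw hu
  have hss := integrable_mul_compProd hK.invariant hs hs
  calc 2 * ∫ x, u x * kernelAct K w x ∂π
      = ∫ z, (u z.1 * w z.2 + w z.1 * u z.2) ∂(π ⊗ₘ K) := by
        rw [integral_add huw hwu, ← integral_mul_kernelAct hK.invariant hu hw,
          ← integral_mul_kernelAct hK.invariant hw hu, integral_mul_kernelAct_comm hK hw hu,
          two_mul]
    _ ≤ ∫ z, √(u z.1 ^ 2 + w z.1 ^ 2) * √(u z.2 ^ 2 + w z.2 ^ 2) ∂(π ⊗ₘ K) :=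
        integral_mono (huw.add hwu) hss fun z => mul_add_mul_le_sqrt_mul_sqrt _ _ _ _
    _ ≤ ∫ x, √(u x ^ 2 + w x ^ 2) ^ 2 * r x ∂π := by
        rw [← integral_mul_kernelAct hK.invariant hs hs]
        exact hform _ hs
    _ = ∫ x, u x ^ 2 * r x ∂π + ∫ x, w x ^ 2 * r x ∂π := by
        rw [← integral_add (integrable_mul_of_mem_boundedMeasurable hu.integrable_sq hr)
          (integrable_mul_of_mem_boundedMeasurable hw.integrable_sq hr)]
        refine integral_congr_ae (.of_forall fun x => ?_)
        simp only [Real.sq_sqrt (add_nonneg (sq_nonneg (u x)) (sq_nonneg (w x))), add_mul]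

theorem integral_sq_tiltedAct_mul_exp_neg_le (hK : K.IsReversible π)
    (hh : h ∈ boundedMeasurable α)
    (hform : ∀ w : α → ℝ, MemLp w 2 π →
      ∫ x, w x * kernelAct K w x ∂π ≤ ∫ x, w x ^ 2 * Real.exp (-h x) ∂π)
    (hw : MemLp w 2 π) :
    ∫ x, tiltedAct K h w x ^ 2 * Real.exp (-h x) ∂π ≤ ∫ x, w x ^ 2 * Real.exp (-h x) ∂π := by
  have hself : ∫ x, tiltedAct K h w x * kernelAct K w x ∂π =
      ∫ x, tiltedAct K h w x ^ 2 * Real.exp (-h x) ∂π := by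
    refine integral_congr_ae (.of_forall fun x => ?_)
    simp only [tiltedAct, Real.exp_neg]
    field_simp
  have hpolar := two_mul_integral_mul_kernelAct_le hK (exp_mem_boundedMeasurable (neg_mem hh))
    hform (memLp_tiltedAct hK.invariant hh hw) hw
  simp only [Pi.neg_apply] at hpolar
  linarith

lemma integral_sq_iterate_tiltedAct_mul_exp_neg_le (hK : K.IsReversible π)
    (hh : h ∈ boundedMeasurable α)
    (hform : ∀ w : α → ℝ, MemLp w 2 π →
      ∫ x, w x * kernelAct K w x ∂π ≤ ∫ x, w x ^ 2 * Real.exp (-h x) ∂π) (m : ℕ) :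
    ∀ {w : α → ℝ}, MemLp w 2 π → ∫ x, (tiltedAct K h)^[m] w x ^ 2 * Real.exp (-h x) ∂π ≤
      ∫ x, w x ^ 2 * Real.exp (-h x) ∂π := by
  induction m with
  | zero => exact fun _ => le_rfl
  | succ m ih =>
    intro w hw
    rw [Function.iterate_succ_apply]
    exact (ih (memLp_tiltedAct hK.invariant hh hw)).trans
      (integral_sq_tiltedAct_mul_exp_neg_le hK hh hform hw)

end TiltedOperator

section InitialDensity

variable {α : Type*} [MeasurableSpace α] {π ν : Measure α}

lemma integral_le_sqrt_mul_densityNorm [SigmaFinite π] [SigmaFinite ν] (hν : HasL2Density ν π)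
    {w : α → ℝ} (hw : MemLp w 2 π) :
    ∫ x, w x ∂ν ≤ √(∫ x, w x ^ 2 ∂π) * densityNorm ν π := by
  rw [← integral_rnDeriv_smul hν.1, ← norm_toLp_sq hw, Real.sqrt_sq (norm_nonneg _), densityNorm,
    ← Lp.norm_toLp _ hν.2, mul_comm]
  simp only [smul_eq_mul, ← inner_toLp_toLp hν.2 hw]
  exact real_inner_le_norm _ _

lemma one_le_densityNorm [IsProbabilityMeasure π] [IsProbabilityMeasure ν]
    (hν : HasL2Density ν π) : 1 ≤ densityNorm ν π := by
  simpa using integral_le_sqrt_mul_densityNorm hν (memLp_const (1 : ℝ))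

end InitialDensity

section FeynmanKacBound

variable {α : Type*} [MeasurableSpace α] {π ν : Measure α} {K : Kernel α α} [IsMarkovKernel K]
  {h : α → ℝ} {b : ℝ}

lemma integral_sq_le_exp_mul_integral_sq_mul_exp_neg (hh : h ∈ boundedMeasurable α)
    (hb : ∀ x, h x ≤ b) {w : α → ℝ} (hw : MemLp w 2 π) :
    ∫ x, w x ^ 2 ∂π ≤ Real.exp b * ∫ x, w x ^ 2 * Real.exp (-h x) ∂π := by
  rw [← integral_const_mul]
  refine integral_mono hw.integrable_sq ((integrable_mul_of_mem_boundedMeasurable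
    hw.integrable_sq (exp_mem_boundedMeasurable (neg_mem hh))).const_mul _) fun x => ?_
  have hone : 1 ≤ Real.exp b * Real.exp (-h x) := by
    rw [← Real.exp_add]
    exact Real.one_le_exp (by linarith [hb x])
  nlinarith [sq_nonneg (w x)]

theorem integral_iterate_tiltedAct_exp_le [IsProbabilityMeasure π] [SigmaFinite ν]
    (hν : HasL2Density ν π) (hK : K.IsReversible π) (hh : h ∈ boundedMeasurable α)
    (hform : ∀ w : α → ℝ, MemLp w 2 π →
      ∫ x, w x * kernelAct K w x ∂π ≤ ∫ x, w x ^ 2 * Real.exp (-h x) ∂π)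
    (hb : ∀ x, h x ≤ b) (m : ℕ) :
    ∫ x, (tiltedAct K h)^[m] (fun y => Real.exp (h y)) x ∂ν ≤ Real.exp b * densityNorm ν π := by
  set F := (tiltedAct K h)^[m] (fun y => Real.exp (h y))
  have hexp := exp_mem_boundedMeasurable hh
  have hF : F ∈ boundedMeasurable α :=
    Set.MapsTo.iterate (fun _ => tiltedAct_mem_boundedMeasurable hh) m hexp
  have hF2 := memLp_of_mem_boundedMeasurable (μ := π) hF 2
  have hstart : ∫ x, Real.exp (h x) ^ 2 * Real.exp (-h x) ∂π ≤ Real.exp b := by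
    refine (integral_mono_of_nonneg (.of_forall fun x => by positivity)
      (integrable_const (Real.exp b)) (.of_forall fun x => ?_)).trans_eq (by simp)
    rw [sq, mul_assoc, ← Real.exp_add, add_neg_cancel, Real.exp_zero, mul_one]
    exact Real.exp_le_exp.2 (hb x)
  have hcontr : ∫ x, F x ^ 2 * Real.exp (-h x) ∂π ≤ Real.exp b :=
    (integral_sq_iterate_tiltedAct_mul_exp_neg_le hK hh hform m
      (memLp_of_mem_boundedMeasurable hexp 2)).trans hstart
  have hnorm : √(∫ x, F x ^ 2 ∂π) ≤ Real.exp b := by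
    refine Real.sqrt_le_iff.2 ⟨(Real.exp_pos b).le, ?_⟩
    refine (integral_sq_le_exp_mul_integral_sq_mul_exp_neg hh hb hF2).trans ?_
    rw [sq]
    gcongr
  exact (integral_le_sqrt_mul_densityNorm hν hF2).trans
    (mul_le_mul_of_nonneg_right hnorm ENNReal.toReal_nonneg)

end FeynmanKacBound

section Path

lemma measurePreserving_init_last {X : Type*} [MeasureSpace X] [SigmaFinite (volume : Measure X)]
    (n : ℕ) : MeasurePreserving (fun u : Fin (n + 1) → X => (Fin.init u, u (Fin.last n)))
      volume (volume.prod volume) := by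
  have hinit : (fun u : Fin (n + 1) → X => (Fin.init u, u (Fin.last n))) =
      Prod.swap ∘ MeasurableEquiv.piFinSuccAbove (fun _ => X) (Fin.last n) := by
    funext u
    exact congrArg (·, u (Fin.last n)) (Fin.removeNth_last u).symm
  rw [hinit]
  exact Measure.measurePreserving_swap.comp
    (volume_preserving_piFinSuccAbove (fun _ : Fin (n + 1) => X) (Fin.last n))

variable {α : Type*} {s : ℕ} {φ : α → Cube s → α} {ψ : Cube s → α}

lemma drivenPoints_castSucc {n : ℕ} (u : Fin (n + 1) → Cube s) (i : Fin n) :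
    drivenPoints φ ψ u i.castSucc = drivenPoints φ ψ (Fin.init u) i := by
  have hstate : ∀ (j : ℕ) (hj : j < n),
      drivenState φ ψ u j (Nat.lt_succ_of_lt hj) = drivenState φ ψ (Fin.init u) j hj := by
    intro j
    induction j with
    | zero => exact fun _ => rfl
    | succ j ih => exact fun hj => congrArg (φ · _) (ih (Nat.lt_of_succ_lt hj))
  exact hstate i i.isLt

lemma drivenPoints_last {n : ℕ} (u : Fin (n + 2) → Cube s) :
    drivenPoints φ ψ u (Fin.last (n + 1)) =
      φ (drivenPoints φ ψ (Fin.init u) (Fin.last n)) (u (Fin.last (n + 1))) :=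
  congrArg (φ · _) (drivenPoints_castSucc u (Fin.last n))

variable [MeasurableSpace α]

lemma measurable_drivenPoints (hφ : Measurable (Function.uncurry φ)) (hψ : Measurable ψ) {n : ℕ}
    (i : Fin n) : Measurable fun u : Fin n → Cube s => drivenPoints φ ψ u i := by
  have hstate : ∀ (j : ℕ) (hj : j < n),
      Measurable fun u : Fin n → Cube s => drivenState φ ψ u j hj := by
    intro j
    induction j with
    | zero => exact fun hj => hψ.comp (measurable_pi_apply _)
    | succ j ih => exact fun hj => hφ.comp ((ih _).prodMk (measurable_pi_apply _))
  exact hstate i i.isLt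

variable {K : Kernel α α} {ν : Measure α} {h : α → ℝ}

lemma measurePreserving_of_isGeneratorFunction (hψ : IsGeneratorFunction ψ ν) :
    MeasurePreserving ψ volume ν :=
  ⟨hψ.1, Measure.ext fun A hA => (Measure.map_apply hψ.1 hA).trans (hψ.2 A hA).symm⟩

lemma measurePreserving_of_isUpdateFunction (hφ : IsUpdateFunction φ K) (x : α) :
    MeasurePreserving (φ x) volume (K x) :=
  ⟨hφ.1.of_uncurry_left, Measure.ext fun A hA =>
    (Measure.map_apply hφ.1.of_uncurry_left hA).trans (hφ.2 x A hA).symm⟩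

theorem integral_exp_sum_mul_drivenPoints [IsMarkovKernel K] (hφ : IsUpdateFunction φ K)
    (hψ : IsGeneratorFunction ψ ν) (hh : h ∈ boundedMeasurable α) (m : ℕ) :
    ∀ {g : α → ℝ}, g ∈ boundedMeasurable α →
      ∫ u : Fin (m + 1) → Cube s, Real.exp (∑ i : Fin m, h (drivenPoints φ ψ u i.castSucc)) *
        g (drivenPoints φ ψ u (Fin.last m)) = ∫ x, (tiltedAct K h)^[m] g x ∂ν := by
  induction m with
  | zero =>
    intro g hg
    simp only [Finset.univ_eq_empty, Finset.sum_empty, Real.exp_zero, one_mul]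
    exact integral_comp_of_measurePreserving
      ((measurePreserving_of_isGeneratorFunction hψ).comp
        (measurePreserving_eval (fun _ : Fin 1 => (volume : Measure (Cube s))) 0))
      hg.1.aestronglyMeasurable
  | succ m ih =>
    intro g hg
    have hpts := fun i : Fin (m + 1) => measurable_drivenPoints hφ.1 hψ.1 i
    set F : (Fin (m + 1) → Cube s) × Cube s → ℝ := fun z =>
      Real.exp (∑ i, h (drivenPoints φ ψ z.1 i)) *
        g (φ (drivenPoints φ ψ z.1 (Fin.last m)) z.2) with hF
    have hFmem : F ∈ boundedMeasurable ((Fin (m + 1) → Cube s) × Cube s) := by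
      have hsum : (fun z : (Fin (m + 1) → Cube s) × Cube s => ∑ i, h (drivenPoints φ ψ z.1 i)) ∈
          boundedMeasurable _ := by
        rw [← Finset.sum_fn]
        exact sum_mem fun i _ => comp_mem_boundedMeasurable hh ((hpts i).comp measurable_fst)
      exact mul_mem (exp_mem_boundedMeasurable hsum) (comp_mem_boundedMeasurable hg
        (hφ.1.comp (((hpts _).comp measurable_fst).prodMk measurable_snd)))
    rw [Function.iterate_succ_apply, ← ih (tiltedAct_mem_boundedMeasurable hh hg)]
    calc _ = ∫ u : Fin (m + 2) → Cube s, F (Fin.init u, u (Fin.last (m + 1))) := by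
          simp only [hF, drivenPoints_castSucc, drivenPoints_last]
      _ = ∫ u, ∫ a, F (u, a) := by
          rw [integral_comp_of_measurePreserving (measurePreserving_init_last (m + 1))
            hFmem.1.aestronglyMeasurable,
            integral_prod _ (integrable_of_mem_boundedMeasurable hFmem)]
      _ = _ := by
          refine integral_congr_ae (.of_forall fun u => ?_)
          simp only [hF, integral_const_mul, Fin.sum_univ_castSucc, Real.exp_add, tiltedAct,
            kernelAct, mul_assoc]
          rw [integral_comp_of_measurePreserving (measurePreserving_of_isUpdateFunction hφ _)
            hg.1.aestronglyMeasurable]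

end Path

section Hoeffding

variable {α : Type*} [MeasurableSpace α] {K : Kernel α α} [IsMarkovKernel K] {π ν : Measure α}
  [IsProbabilityMeasure π] {s : ℕ} {φ : α → Cube s → α} {ψ : Cube s → α} {f h : α → ℝ}
  {Λ t c : ℝ} {n : ℕ}

lemma integral_exp_sum_drivenPoints_le [SigmaFinite ν] (hK : K.IsReversible π)
    (hν : HasL2Density ν π) (hφ : IsUpdateFunction φ K) (hψ : IsGeneratorFunction ψ ν)
    (hh : h ∈ boundedMeasurable α)
    (hform : ∀ w : α → ℝ, MemLp w 2 π →
      ∫ x, w x * kernelAct K w x ∂π ≤ ∫ x, w x ^ 2 * Real.exp (-h x) ∂π)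
    {b : ℝ} (hb : ∀ x, h x ≤ b) (hn : 0 < n) :
    ∫ u : Fin n → Cube s, Real.exp (∑ i, h (drivenPoints φ ψ u i)) ≤
      Real.exp b * densityNorm ν π := by
  obtain ⟨m, rfl⟩ := Nat.exists_eq_add_one.2 hn
  simp only [Fin.sum_univ_castSucc, Real.exp_add]
  rw [integral_exp_sum_mul_drivenPoints hφ hψ hh m (exp_mem_boundedMeasurable hh)]
  exact integral_iterate_tiltedAct_exp_le hν hK hh hform hb m

lemma integral_mem_Icc_of_mem_Icc (hf : Measurable f) (hf01 : ∀ x, f x ∈ Set.Icc 0 1) :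
    ∫ x, f x ∂π ∈ Set.Icc 0 1 :=
  ⟨integral_nonneg fun x => (hf01 x).1,
    (integral_mono (integrable_of_mem_boundedMeasurable
      (mem_boundedMeasurable_of_mem_Icc hf hf01)) (integrable_const 1)
      fun x => (hf01 x).2).trans_eq (by simp)⟩

theorem mgf_sum_drivenPoints_le [SigmaFinite ν] (hK : K.IsReversible π) (hν : HasL2Density ν π)
    (hφ : IsUpdateFunction φ K) (hψ : IsGeneratorFunction ψ ν) (hspec : spectralSup K π hK ≤ Λ)
    (hΛ : Λ < 1) (hf : Measurable f) (hf01 : ∀ x, f x ∈ Set.Icc 0 1) (ht : 0 ≤ t) (hn : 0 < n) :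
    mgf (fun u : Fin n → Cube s => ∑ i, (f (drivenPoints φ ψ u i) - ∫ x, f x ∂π)) volume t ≤
      Real.exp t * densityNorm ν π * Real.exp (n * (t ^ 2 / (2 * (1 - Λ)))) := by
  have : 0 < 1 - Λ := sub_pos.2 hΛ
  set μ := ∫ x, f x ∂π
  set S := t ^ 2 / (2 * (1 - Λ))
  have hS0 : 0 ≤ S := by positivity
  set h : α → ℝ := fun x => t * (f x - μ) - S with hh
  have hμ0 : 0 ≤ μ := (integral_mem_Icc_of_mem_Icc hf hf01).1
  have hbound : ∀ x, h x ∈ Set.Icc (-(t * μ) - S) t := fun x => by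
    have h0 := mul_nonneg ht (hf01 x).1
    have h1 := mul_le_mul_of_nonneg_left (hf01 x).2 ht
    have h2 := mul_nonneg ht hμ0
    constructor <;> simp only [hh] <;> linarith
  have hmem : h ∈ boundedMeasurable α :=
    mem_boundedMeasurable_of_mem_Icc (((hf.sub_const μ).const_mul t).sub_const S) hbound
  have hsum : ∀ u : Fin n → Cube s, t * ∑ i, (f (drivenPoints φ ψ u i) - μ) =
      ∑ i, h (drivenPoints φ ψ u i) + n * S := fun u => by
    simp [hh, ← Finset.mul_sum]
  simp only [mgf, hsum, Real.exp_add, integral_mul_const]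
  gcongr
  exact integral_exp_sum_drivenPoints_le hK hν hφ hψ hmem (fun w hw =>
    integral_mul_kernelAct_le_integral_sq_mul_exp hK hspec hΛ hf hf01 ht hw)
    (fun x => (hbound x).2) hn

theorem measureReal_le_sum_drivenPoints_le [SigmaFinite ν] (hK : K.IsReversible π)
    (hν : HasL2Density ν π) (hφ : IsUpdateFunction φ K) (hψ : IsGeneratorFunction ψ ν)
    (hspec : spectralSup K π hK ≤ Λ) (hΛ : Λ < 1) (hf : Measurable f)
    (hf01 : ∀ x, f x ∈ Set.Icc 0 1) (hc : 0 ≤ c) (hn : 0 < n) :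
    volume.real {u : Fin n → Cube s |
        n * c ≤ ∑ i, (f (drivenPoints φ ψ u i) - ∫ x, f x ∂π)} ≤
      Real.exp (c * (1 - Λ)) * densityNorm ν π * Real.exp (-(n * c ^ 2 * (1 - Λ) / 2)) := by
  have hgap : 0 < 1 - Λ := sub_pos.2 hΛ
  -- `t = c (1 - Λ)` minimises the exponent `-t c + t ^ 2 / (2 (1 - Λ))`.
  have ht : 0 ≤ c * (1 - Λ) := by positivity
  have hdev : (fun u : Fin n → Cube s => ∑ i, (f (drivenPoints φ ψ u i) - ∫ x, f x ∂π)) ∈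
      boundedMeasurable (Fin n → Cube s) := by
    rw [← Finset.sum_fn]
    exact sum_mem fun i _ => sub_mem (comp_mem_boundedMeasurable
      (mem_boundedMeasurable_of_mem_Icc hf hf01) (measurable_drivenPoints hφ.1 hψ.1 i))
      (algebraMap_mem (boundedMeasurable _) _)
  have hexp := exp_mem_boundedMeasurable
    (Subalgebra.smul_mem _ hdev (c * (1 - Λ)))
  refine (measure_ge_le_exp_mul_mgf (n * c) ht (integrable_of_mem_boundedMeasurable hexp)).trans ?_
  refine (mul_le_mul_of_nonneg_left
    (mgf_sum_drivenPoints_le hK hν hφ hψ hspec hΛ hf hf01 ht hn) (Real.exp_pos _).le).trans_eq ?_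
  rw [mul_left_comm, ← Real.exp_add]
  congr 2
  field_simp
  ring

end Hoeffding

section Bracketing

/-- The pairs `L i ⊆ U i` of measurable sets form a `δ`-bracketing (the `δ`-cover of discrepancy
theory) of the class `𝒜` of test sets: the gaps `U i \ L i` have measure at most `δ` and each member
of `𝒜` lies between `L i` and `U i` for some `i`. Members of `𝒜` need not be measurable. -/
structure IsBracketing {α ι : Type*} [MeasurableSpace α] (μ : Measure α) (𝒜 : Set (Set α)) (δ : ℝ)
    (L U : ι → Set α) : Prop where
  measurableSet_lower : ∀ i, MeasurableSet (L i)
  measurableSet_upper : ∀ i, MeasurableSet (U i)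
  measureReal_gap_le : ∀ i, μ.real (U i \ L i) ≤ δ
  exists_between : ∀ A ∈ 𝒜, ∃ i, L i ⊆ A ∧ A ⊆ U i

section HalfLine

variable {X : Type*} [LinearOrder X] [TopologicalSpace X] [OrderClosedTopology X]
  [MeasurableSpace X] [BorelSpace X] (μ : Measure X) [IsFiniteMeasure μ]

lemma measurable_measureReal_Iio : Measurable fun y => μ.real (Set.Iio y) :=
  Monotone.measurable fun _ _ h => measureReal_mono (Set.Iio_subset_Iio h)

lemma measurable_measureReal_Iic : Measurable fun y => μ.real (Set.Iic y) :=
  Monotone.measurable fun _ _ h => measureReal_mono (Set.Iic_subset_Iic.2 h)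

lemma measureReal_quantile_gap_le [μ.InnerRegularCompactLTTop] {p q : ℝ} (hqp : q ≤ p) :
    μ.real {y | q ≤ μ.real (Set.Iio y) ∧ μ.real (Set.Iic y) ≤ p} ≤ p - q := by
  have hmeas : MeasurableSet {y | q ≤ μ.real (Set.Iio y) ∧ μ.real (Set.Iic y) ≤ p} :=
    (measurableSet_le measurable_const (measurable_measureReal_Iio μ)).inter
      (measurableSet_le (measurable_measureReal_Iic μ) measurable_const)
  refine ENNReal.toReal_le_of_le_ofReal (sub_nonneg.2 hqp) ?_
  rw [hmeas.measure_eq_iSup_isCompact_of_ne_top (measure_ne_top μ _)]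
  refine iSup₂_le fun C hC => iSup_le fun hcompact => ?_
  obtain rfl | hne := C.eq_empty_or_nonempty
  · simp
  obtain ⟨a, ha, hamin⟩ := hcompact.exists_isLeast hne
  obtain ⟨b, hb, hbmax⟩ := hcompact.exists_isGreatest hne
  have hsub : C ⊆ Set.Iic b \ Set.Iio a := fun y hy => ⟨hbmax hy, not_lt.2 (hamin hy)⟩
  have hdiff := measureReal_sdiff (μ := μ)
    (Set.Iio_subset_Iic_self.trans (Set.Iic_subset_Iic.2 (hbmax ha))) (measurableSet_Iio (a := a))
  refine (measure_mono hsub).trans ?_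
  rw [← ofReal_measureReal, hdiff]
  exact ENNReal.ofReal_le_ofReal (sub_le_sub (hC hb).2 (hC ha).1)

end HalfLine

lemma exists_fin_div_le_and_le_div {k : ℕ} (hk : 0 < k) {r : ℝ} (hr : r ∈ Set.Icc (0 : ℝ) 1) :
    ∃ i : Fin k, (i / k : ℝ) ≤ r ∧ r ≤ (i + 1) / k := by
  have hk' : (0 : ℝ) < k := Nat.cast_pos.2 hk
  obtain hr1 | rfl := hr.2.lt_or_eq
  · have hrk : 0 ≤ r * k := mul_nonneg hr.1 hk'.le
    exact ⟨⟨⌊r * k⌋₊, (Nat.floor_lt hrk).2 (mul_lt_of_lt_one_left hk' hr1)⟩,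
      (div_le_iff₀ hk').2 (Nat.floor_le hrk),
      (le_div_iff₀ hk').2 (Nat.lt_floor_add_one _).le⟩
  · refine ⟨⟨k - 1, Nat.sub_one_lt hk.ne'⟩, ?_⟩
    simp [Nat.cast_pred hk, div_le_one hk', div_self hk'.ne']

theorem isBracketing_Iio {X : Type*} [LinearOrder X] [TopologicalSpace X] [OrderClosedTopology X]
    [MeasurableSpace X] [BorelSpace X] (μ : Measure X) [IsProbabilityMeasure μ]
    [μ.InnerRegularCompactLTTop] {k : ℕ} (hk : 0 < k) :
    IsBracketing μ (Set.range Set.Iio) (1 / k)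
      (fun i : Fin k => {y | μ.real (Set.Iio y) < i / k})
      (fun i : Fin k => {y | μ.real (Set.Iic y) ≤ (i + 1) / k}) where
  measurableSet_lower _ := measurableSet_lt (measurable_measureReal_Iio μ) measurable_const
  measurableSet_upper _ := measurableSet_le (measurable_measureReal_Iic μ) measurable_const
  measureReal_gap_le i := by
    have hstep : (i / k : ℝ) ≤ (i + 1) / k := by gcongr; linarith
    refine (measureReal_mono ?_).trans ((measureReal_quantile_gap_le μ hstep).trans_eq (by ring))
    exact fun y hy => ⟨not_lt.1 hy.2, hy.1⟩
  exists_between := by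
    rintro _ ⟨x, rfl⟩
    obtain ⟨i, hi, hi'⟩ := exists_fin_div_le_and_le_div hk
      (r := μ.real (Set.Iio x)) ⟨measureReal_nonneg, measureReal_le_one⟩
    refine ⟨i, fun y hy => ?_, fun y hy => ?_⟩
    · by_contra hxy
      exact (hi.trans (measureReal_mono (Set.Iio_subset_Iio (not_lt.1 hxy)))).not_gt hy
    · exact (measureReal_mono (Set.Iic_subset_Iio.2 hy)).trans hi'

theorem IsBracketing.iInter_preimage {α κ : Type*} [MeasurableSpace α] {μ : Measure α}
    [IsFiniteMeasure μ] [Fintype κ] {X ι : κ → Type*} [∀ j, MeasurableSpace (X j)]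
    {f : ∀ j, α → X j} (hf : ∀ j, Measurable (f j)) {𝒜 : ∀ j, Set (Set (X j))} {δ : κ → ℝ}
    {L U : ∀ j, ι j → Set (X j)} (h : ∀ j, IsBracketing (μ.map (f j)) (𝒜 j) (δ j) (L j) (U j)) :
    IsBracketing μ {A | ∃ B : ∀ j, Set (X j), (∀ j, B j ∈ 𝒜 j) ∧ A = ⋂ j, f j ⁻¹' B j}
      (∑ j, δ j) (fun i : ∀ j, ι j => ⋂ j, f j ⁻¹' L j (i j))
      (fun i : ∀ j, ι j => ⋂ j, f j ⁻¹' U j (i j)) where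
  measurableSet_lower i := .iInter fun j => hf j ((h j).measurableSet_lower (i j))
  measurableSet_upper i := .iInter fun j => hf j ((h j).measurableSet_upper (i j))
  measureReal_gap_le i := by
    have hsub : (⋂ j, f j ⁻¹' U j (i j)) \ ⋂ j, f j ⁻¹' L j (i j) ⊆
        ⋃ j, f j ⁻¹' (U j (i j) \ L j (i j)) := by
      rintro y ⟨hyU, hyL⟩
      obtain ⟨j, hj⟩ := not_forall.1 fun hy => hyL (Set.mem_iInter.2 hy)
      exact Set.mem_iUnion.2 ⟨j, Set.mem_iInter.1 hyU j, hj⟩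
    refine (measureReal_mono hsub).trans ((measureReal_iUnion_fintype_le _).trans
      (Finset.sum_le_sum fun j _ => ?_))
    rw [← map_measureReal_apply (hf j)
      (((h j).measurableSet_upper _).diff ((h j).measurableSet_lower _))]
    exact (h j).measureReal_gap_le (i j)
  exists_between := by
    rintro _ ⟨B, hB, rfl⟩
    choose i hi using fun j => (h j).exists_between (B j) (hB j)
    exact ⟨i, Set.iInter_mono fun j => Set.preimage_mono (hi j).1,
      Set.iInter_mono fun j => Set.preimage_mono (hi j).2⟩

theorem exists_isBracketing_anchoredBoxes {d : ℕ} (G : Set (Fin d → ℝ)) (π : Measure G)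
    [IsProbabilityMeasure π] {k : ℕ} (hk : 0 < k) :
    ∃ L U : (Fin d → Fin k) → Set G, IsBracketing π (anchoredBoxes G) (d / k) L U := by
  have hcoord : ∀ j, Measurable fun y : G => (y : Fin d → ℝ) j := fun j =>
    (measurable_pi_apply j).comp measurable_subtype_coe
  have hprob := fun j => Measure.isProbabilityMeasure_map (μ := π) (hcoord j).aemeasurable
  have hbox := IsBracketing.iInter_preimage hcoord fun j =>
    isBracketing_Iio (π.map fun y : G => (y : Fin d → ℝ) j) hk
  refine ⟨_, _, hbox.measurableSet_lower, hbox.measurableSet_upper,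
    fun i => (hbox.measureReal_gap_le i).trans_eq (by simp [div_eq_mul_inv]), ?_⟩
  rintro A ⟨x, rfl⟩
  refine hbox.exists_between _ ⟨fun j => Set.Iio (x j), fun j => ⟨x j, rfl⟩, ?_⟩
  ext y
  simp

end Bracketing

section Discrepancy

variable {α : Type*}

lemma indicator_one_mem_Icc (A : Set α) (y : α) :
    A.indicator (fun _ => (1 : ℝ)) y ∈ Set.Icc (0 : ℝ) 1 :=
  ⟨Set.indicator_nonneg (fun _ _ => zero_le_one) y,
    Set.indicator_le_self' (fun _ _ => zero_le_one) y⟩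

variable [MeasurableSpace α] {π : Measure α} {n : ℕ}

lemma starDiscrepancy_nonneg (𝒜 : Set (Set α)) (π : Measure α) (x : Fin n → α) :
    0 ≤ starDiscrepancy 𝒜 π x :=
  Real.iSup_nonneg fun _ => abs_nonneg _

lemma starDiscrepancy_le_one [IsProbabilityMeasure π] (𝒜 : Set (Set α)) (x : Fin n → α) :
    starDiscrepancy 𝒜 π x ≤ 1 := by
  refine Real.iSup_le (fun A => ?_) zero_le_one
  refine abs_sub_le_of_nonneg_of_le ?_ ?_ measureReal_nonneg measureReal_le_one
  · exact mul_nonneg (by positivity)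
      (Finset.sum_nonneg fun i _ => (indicator_one_mem_Icc _ _).1)
  · rw [one_div_mul_eq_div]
    exact div_le_one_of_le₀ ((Finset.sum_le_sum fun i _ =>
      (indicator_one_mem_Icc _ (x i)).2).trans_eq (by simp)) n.cast_nonneg

lemma abs_sub_le_of_subset_of_subset [IsProbabilityMeasure π] (hn : 0 < n) (x : Fin n → α)
    {L A U : Set α} (hL : MeasurableSet L) (hLA : L ⊆ A) (hAU : A ⊆ U) {c δ : ℝ}
    (hgap : π.real (U \ L) ≤ δ)
    (hU : ∑ i, (U.indicator (fun _ => (1 : ℝ)) (x i) - π.real U) ≤ n * c)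
    (hLc : ∑ i, (Lᶜ.indicator (fun _ => (1 : ℝ)) (x i) - π.real Lᶜ) ≤ n * c) :
    |1 / (n : ℝ) * ∑ i, A.indicator (fun _ => (1 : ℝ)) (x i) - π.real A| ≤ c + δ := by
  have hn' : (0 : ℝ) < n := Nat.cast_pos.2 hn
  have hπL : π.real L ≤ π.real A := measureReal_mono hLA
  have hπU : π.real A ≤ π.real U := measureReal_mono hAU
  have hcompl : ∑ i, Lᶜ.indicator (fun _ => (1 : ℝ)) (x i) =
      n - ∑ i, L.indicator (fun _ => (1 : ℝ)) (x i) := by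
    simp [Set.indicator_compl]
  have hsumL : ∑ i, L.indicator (fun _ => (1 : ℝ)) (x i) ≤
      ∑ i, A.indicator (fun _ => (1 : ℝ)) (x i) :=
    Finset.sum_le_sum fun i _ => Set.indicator_le_indicator_of_subset hLA (fun _ => zero_le_one) _
  have hsumU : ∑ i, A.indicator (fun _ => (1 : ℝ)) (x i) ≤
      ∑ i, U.indicator (fun _ => (1 : ℝ)) (x i) :=
    Finset.sum_le_sum fun i _ => Set.indicator_le_indicator_of_subset hAU (fun _ => zero_le_one) _
  rw [measureReal_sdiff (hLA.trans hAU) hL] at hgap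
  simp only [Finset.sum_sub_distrib, hcompl, probReal_compl_eq_one_sub hL, Finset.sum_const,
    Finset.card_univ, Fintype.card_fin, nsmul_eq_mul] at hU hLc
  have hfreq (S p : ℝ) : 1 / (n : ℝ) * S - p = (S - n * p) / n := by field_simp
  rw [hfreq, abs_le, le_div_iff₀ hn', div_le_iff₀ hn']
  constructor <;> nlinarith

variable {ν : Measure α} [IsProbabilityMeasure π] [SigmaFinite ν] {K : Kernel α α}
  [IsMarkovKernel K] {ι : Type*} [Fintype ι] {s : ℕ} {φ : α → Cube s → α} {ψ : Cube s → α}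
  {Λ c δ : ℝ}

lemma exists_forall_sum_indicator_drivenPoints_lt (hK : K.IsReversible π) (hν : HasL2Density ν π)
    (hφ : IsUpdateFunction φ K) (hψ : IsGeneratorFunction ψ ν) (hspec : spectralSup K π hK ≤ Λ)
    (hΛ : Λ < 1) (hn : 0 < n) (hc : 0 ≤ c) {B : ι → Set α} (hB : ∀ i, MeasurableSet (B i))
    (hsmall : Fintype.card ι * (Real.exp (c * (1 - Λ)) * densityNorm ν π *
      Real.exp (-(n * c ^ 2 * (1 - Λ) / 2))) < 1) :
    ∃ u : Fin n → Cube s, ∀ i,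
      ∑ j, ((B i).indicator (fun _ => (1 : ℝ)) (drivenPoints φ ψ u j) - π.real (B i)) < n * c := by
  set bad : ι → Set (Fin n → Cube s) := fun i => {u | n * c ≤
    ∑ j, ((B i).indicator (fun _ => (1 : ℝ)) (drivenPoints φ ψ u j) - π.real (B i))}
  have htail : ∀ i, volume.real (bad i) ≤ Real.exp (c * (1 - Λ)) * densityNorm ν π *
      Real.exp (-(n * c ^ 2 * (1 - Λ) / 2)) := fun i => by
    have hint : ∫ x, (B i).indicator (fun _ => (1 : ℝ)) x ∂π = π.real (B i) :=
      integral_indicator_one (hB i)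
    have := measureReal_le_sum_drivenPoints_le hK hν hφ hψ hspec hΛ
      (measurable_const.indicator (hB i)) (indicator_one_mem_Icc (B i)) hc hn
    rwa [hint] at this
  have hunion : volume.real (⋃ i, bad i) < 1 :=
    ((measureReal_iUnion_fintype_le bad).trans (Finset.sum_le_sum fun i _ => htail i)).trans_lt
      (by simpa using hsmall)
  obtain ⟨u, hu⟩ : ∃ u, u ∉ ⋃ i, bad i := by
    by_contra! hall
    rw [Set.eq_univ_of_forall hall, probReal_univ] at hunion
    exact lt_irrefl _ hunion
  exact ⟨u, fun i => not_le.1 fun hi => hu (Set.mem_iUnion.2 ⟨i, hi⟩)⟩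

theorem exists_starDiscrepancy_drivenPoints_le (hK : K.IsReversible π) (hν : HasL2Density ν π)
    (hφ : IsUpdateFunction φ K) (hψ : IsGeneratorFunction ψ ν) (hspec : spectralSup K π hK ≤ Λ)
    (hΛ : Λ < 1) {𝒜 : Set (Set α)} {L U : ι → Set α} (hbr : IsBracketing π 𝒜 δ L U) (hδ : 0 ≤ δ)
    (hn : 0 < n) (hc : 0 ≤ c)
    (hsmall : 2 * Fintype.card ι * (Real.exp (c * (1 - Λ)) * densityNorm ν π *
      Real.exp (-(n * c ^ 2 * (1 - Λ) / 2))) < 1) :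
    ∃ u : Fin n → Cube s, starDiscrepancy 𝒜 π (drivenPoints φ ψ u) ≤ c + δ := by
  obtain ⟨u, hu⟩ := exists_forall_sum_indicator_drivenPoints_lt hK hν hφ hψ hspec hΛ hn hc
    (B := Sum.elim U fun i => (L i)ᶜ)
    (Sum.rec hbr.measurableSet_upper fun i => (hbr.measurableSet_lower i).compl)
    (by simpa [two_mul] using hsmall)
  refine ⟨u, Real.iSup_le (fun A => ?_) (add_nonneg hc hδ)⟩
  obtain ⟨i, hLA, hAU⟩ := hbr.exists_between A A.2
  exact abs_sub_le_of_subset_of_subset hn _ (hbr.measurableSet_lower i) hLA hAU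
    (hbr.measureReal_gap_le i) (hu (.inl i)).le (hu (.inr i)).le

end Discrepancy

section Constants

lemma two_mul_exp_one_mul_pow_lt {d : ℕ} (hd : 1 ≤ d) :
    2 * Real.exp 1 * (d : ℝ) ^ d < Real.exp (3 * (d : ℝ) ^ 2 * Real.log (5 * d)) := by
  have hd' : (1 : ℝ) ≤ d := Nat.one_le_cast.2 hd
  have hbase : 2 * Real.exp 1 < (5 * d : ℝ) ^ 2 := by nlinarith [Real.exp_one_lt_d9]
  calc 2 * Real.exp 1 * (d : ℝ) ^ d
      < (5 * d : ℝ) ^ 2 * (5 * d : ℝ) ^ d := by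
        refine mul_lt_mul hbase ?_ (by positivity) (by positivity)
        gcongr
        linarith
    _ = (5 * d : ℝ) ^ (2 + d) := (pow_add _ _ _).symm
    _ ≤ (5 * d : ℝ) ^ (3 * d ^ 2) := pow_le_pow_right₀ (by linarith) (by nlinarith)
    _ = Real.exp (3 * (d : ℝ) ^ 2 * Real.log (5 * d)) := by
        rw [← Real.rpow_natCast, Real.rpow_def_of_pos (by positivity), mul_comm]
        push_cast
        ring_nf

lemma two_mul_pow_mul_exp_neg_lt_one {d n k : ℕ} (hd : 1 ≤ d) (hn : 0 < n)
    (hk : (k : ℝ) ≤ d * n) {D : ℝ} (hD : 0 < D) :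
    2 * (k : ℝ) ^ d * (Real.exp 1 * D * Real.exp (-(Real.log D + d * Real.log n +
      3 * (d : ℝ) ^ 2 * Real.log (5 * d)))) < 1 := by
  have : (0 : ℝ) < n := Nat.cast_pos.2 hn
  rw [Real.exp_neg, Real.exp_add, Real.exp_add, Real.exp_log hD, ← Real.log_pow,
    Real.exp_log (by positivity), ← mul_assoc, ← div_eq_mul_inv, div_lt_one (by positivity)]
  calc 2 * (k : ℝ) ^ d * (Real.exp 1 * D)
      ≤ 2 * ((d : ℝ) * n) ^ d * (Real.exp 1 * D) := by gcongr
    _ = D * (n : ℝ) ^ d * (2 * Real.exp 1 * (d : ℝ) ^ d) := by ring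
    _ < _ := by
        gcongr
        exact two_mul_exp_one_mul_pow_lt hd

lemma exists_grid_size {d n : ℕ} (hd : 0 < d) (hn : 0 < n) :
    ∃ k : ℕ, 0 < k ∧ (k : ℝ) ≤ d * n ∧ (d : ℝ) / k ≤ 8 / (n : ℝ) ^ (3 / 4 : ℝ) := by
  have hn1 : (1 : ℝ) ≤ n := Nat.one_le_cast.2 hn
  set y : ℝ := (n : ℝ) ^ (3 / 4 : ℝ)
  have hy : 0 < y := by positivity
  have hyn : y ≤ n := Real.rpow_le_self_of_one_le hn1 (by norm_num)
  have hceil : 0 < ⌈d * y / 8⌉₊ := Nat.ceil_pos.2 (by positivity)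
  refine ⟨⌈d * y / 8⌉₊, hceil, ?_, ?_⟩
  · have hle : d * y / 8 ≤ (d * n : ℕ) := by
      push_cast
      exact (div_le_self (by positivity) (by norm_num)).trans (by gcongr)
    exact_mod_cast Nat.ceil_le.2 hle
  · rw [div_le_div_iff₀ (Nat.cast_pos.2 hceil) hy]
    linarith [Nat.le_ceil (d * y / 8)]

lemma mul_sqrt_log_div_sqrt_add_le {A B C a b : ℝ} (hA : 0 ≤ A) (hB : 0 ≤ B) {n : ℕ}
    (hn : 3 ≤ n) :
    A * (√(C + a * Real.log n + b) / √n) + B / (n : ℝ) ^ (3 / 4 : ℝ) ≤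
      (A * √(|C| + |a| + |b|) + B) * (√(Real.log n) / √n) := by
  have hn' : (3 : ℝ) ≤ n := Nat.ofNat_le_cast.2 hn
  have hlog : 1 ≤ Real.log n := by
    rw [Real.le_log_iff_exp_le (by linarith)]
    linarith [Real.exp_one_lt_d9]
  have hsplit : √(C + a * Real.log n + b) ≤ √(|C| + |a| + |b|) * √(Real.log n) := by
    rw [← Real.sqrt_mul (by positivity)]
    refine Real.sqrt_le_sqrt ?_
    nlinarith [le_abs_self C, le_abs_self a, le_abs_self b, abs_nonneg C, abs_nonneg b]
  have hroot : √(n : ℝ) ≤ (n : ℝ) ^ (3 / 4 : ℝ) := by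
    rw [Real.sqrt_eq_rpow]
    exact Real.rpow_le_rpow_of_exponent_le (by linarith) (by norm_num)
  calc A * (√(C + a * Real.log n + b) / √n) + B / (n : ℝ) ^ (3 / 4 : ℝ)
      ≤ A * (√(|C| + |a| + |b|) * √(Real.log n) / √n) + B * √(Real.log n) / √n := by
        gcongr
        exact le_mul_of_one_le_right hB (Real.one_le_sqrt.2 hlog)
    _ = _ := by ring

lemma isBigO_mul_sqrt_log_div_sqrt_add {A B : ℝ} (hA : 0 ≤ A) (hB : 0 ≤ B) (C a b : ℝ) :
    (fun n : ℕ => A * (√(C + a * Real.log n + b) / √n) + B / (n : ℝ) ^ (3 / 4 : ℝ))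
      =O[Filter.atTop] fun n : ℕ => (n : ℝ) ^ (-(1 / 2) : ℝ) * (Real.log n) ^ (1 / 2 : ℝ) := by
  refine .of_bound (A * √(|C| + |a| + |b|) + B) ?_
  filter_upwards [Filter.eventually_ge_atTop 3] with n hn
  have := Real.log_natCast_nonneg n
  rw [Real.norm_of_nonneg (by positivity), Real.norm_of_nonneg (by positivity),
    Real.rpow_neg n.cast_nonneg, ← Real.sqrt_eq_rpow, ← Real.sqrt_eq_rpow, inv_mul_eq_div]
  exact mul_sqrt_log_div_sqrt_add_le hA hB hn

end Constants

section AnchoredBoxes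

variable {d s n : ℕ} {G : Set (Fin d → ℝ)} {π ν : Measure G} [IsProbabilityMeasure π]
  {K : Kernel G G} [IsMarkovKernel K] {φ : G → Cube s → G} {ψ : Cube s → G} {Λ : ℝ}

theorem exists_starDiscrepancy_anchoredBoxes_le [IsProbabilityMeasure ν] (hd : 1 ≤ d)
    (hK : K.IsReversible π) (hν : HasL2Density ν π) (hφ : IsUpdateFunction φ K)
    (hψ : IsGeneratorFunction ψ ν) (hspec : spectralSup K π hK ≤ Λ) (hΛ0 : 0 ≤ Λ) (hΛ : Λ < 1)
    (hn : 0 < n) :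
    ∃ u : Fin n → Cube s, starDiscrepancy (anchoredBoxes G) π (drivenPoints φ ψ u) ≤
      √(1 / (1 - Λ)) * (√2 * √(Real.log (densityNorm ν π) + d * Real.log n
        + 3 * (d : ℝ) ^ 2 * Real.log (5 * d)) / √n) + 8 / (n : ℝ) ^ (3 / 4 : ℝ) := by
  have hd' : (1 : ℝ) ≤ d := Nat.one_le_cast.2 hd
  have hgap : 0 < 1 - Λ := sub_pos.2 hΛ
  have hlogD := Real.log_nonneg (one_le_densityNorm hν)
  have hlog5 : 0 ≤ Real.log (5 * d) := Real.log_nonneg (by linarith)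
  set M := Real.log (densityNorm ν π) + d * Real.log n + 3 * (d : ℝ) ^ 2 * Real.log (5 * d)
  have hM : 0 ≤ M := by positivity
  set c := √(1 / (1 - Λ)) * (√2 * √M / √n) with hc
  -- For `c > 1` the claim is weaker than the trivial bound by `1`.
  obtain hc1 | hc1 := lt_or_ge 1 c
  · exact ⟨fun _ _ => 0, (starDiscrepancy_le_one _ _).trans
      (hc1.le.trans (le_add_of_nonneg_right (by positivity)))⟩
  obtain ⟨k, hk, hkn, hkd⟩ := exists_grid_size hd hn
  obtain ⟨L, U, hbr⟩ := exists_isBracketing_anchoredBoxes G π hk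
  have hexponent : n * c ^ 2 * (1 - Λ) / 2 = M := by
    rw [hc, mul_pow, div_pow, mul_pow, Real.sq_sqrt (by positivity), Real.sq_sqrt zero_le_two,
      Real.sq_sqrt hM, Real.sq_sqrt n.cast_nonneg]
    field_simp
  have hsmall : 2 * Fintype.card (Fin d → Fin k) * (Real.exp (c * (1 - Λ)) * densityNorm ν π *
      Real.exp (-(n * c ^ 2 * (1 - Λ) / 2))) < 1 := by
    rw [hexponent, Fintype.card_fun, Fintype.card_fin, Fintype.card_fin, Nat.cast_pow]
    refine lt_of_le_of_lt ?_ (two_mul_pow_mul_exp_neg_lt_one hd hn hkn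
      (zero_lt_one.trans_le (one_le_densityNorm hν)))
    have := one_le_densityNorm hν
    gcongr
    exact mul_le_one₀ hc1 hgap.le (by linarith)
  exact (exists_starDiscrepancy_drivenPoints_le hK hν hφ hψ hspec hΛ hbr (by positivity) hn
    (by positivity) hsmall).imp fun u hu => hu.trans (by gcongr)

end AnchoredBoxes

end MCQMC

theorem mainTheorem2_general {d s : ℕ} (hd : 1 ≤ d) (G : Set (Fin d → ℝ)) (π ν : Measure G)
    [IsProbabilityMeasure π] [IsProbabilityMeasure ν] (K : Kernel G G) [IsMarkovKernel K]
    (hK : K.IsReversible π) (hvb : MCQMC.IsVarianceBounding K π hK)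
    (hν : MCQMC.HasL2Density ν π) (φ : G → MCQMC.Cube s → G) (hφ : MCQMC.IsUpdateFunction φ K)
    (ψ : MCQMC.Cube s → G) (hψ : MCQMC.IsGeneratorFunction ψ ν)
    (Λ₀ : ℝ) (hΛ₀ : Λ₀ = max (MCQMC.spectralSup K π hK) 0) :
    (∀ n : ℕ, 0 < n → ∃ u : Fin n → MCQMC.Cube s,
      MCQMC.starDiscrepancy (MCQMC.anchoredBoxes G) π (MCQMC.drivenPoints φ ψ u) ≤
        √(1 / (1 - Λ₀)) *
          (√2 * √(Real.log (MCQMC.densityNorm ν π) + d * Real.log n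
            + 3 * (d : ℝ) ^ 2 * Real.log (5 * d)) / √n)
        + 8 / (n : ℝ) ^ (3 / 4 : ℝ)) ∧
    ∃ u : (n : ℕ) → Fin n → MCQMC.Cube s,
      (fun n : ℕ =>
        MCQMC.starDiscrepancy (MCQMC.anchoredBoxes G) π (MCQMC.drivenPoints φ ψ (u n)))
        =O[Filter.atTop]
      (fun n : ℕ => (n : ℝ) ^ (-(1 / 2) : ℝ) * (Real.log n) ^ (1 / 2 : ℝ)) := by
  have hbound := fun (n : ℕ) (hn : 0 < n) =>
    MCQMC.exists_starDiscrepancy_anchoredBoxes_le (n := n) hd hK hν hφ hψ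
      (hΛ₀ ▸ le_max_left _ _) (hΛ₀ ▸ le_max_right _ _) (hΛ₀ ▸ max_lt hvb one_pos) hn
  refine ⟨hbound, ?_⟩
  have hsequence : ∀ n : ℕ, ∃ u : Fin n → MCQMC.Cube s, 0 < n → _ := fun n =>
    n.eq_zero_or_pos.elim (fun h0 => ⟨fun _ _ => 0, fun h => absurd h0 h.ne'⟩)
      fun hn => (hbound n hn).imp fun _ hu _ => hu
  choose u hu using hsequence
  refine ⟨u, (Asymptotics.IsBigO.of_bound' ?_).trans
    (MCQMC.isBigO_mul_sqrt_log_div_sqrt_add (A := √(1 / (1 - Λ₀)) * √2) (B := 8) (by positivity)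
      (by norm_num) (Real.log (MCQMC.densityNorm ν π)) d (3 * (d : ℝ) ^ 2 * Real.log (5 * d)))⟩
  filter_upwards [Filter.eventually_gt_atTop 0] with n hn
  rw [Real.norm_of_nonneg (MCQMC.starDiscrepancy_nonneg _ _ _)]
  refine (hu n hn).trans (le_of_eq_of_le ?_ (Real.le_norm_self _))
  ring

theorem mainTheorem2 {d s : ℕ} (hd : 1 ≤ d) (G : Set (Fin d → ℝ)) (hG : Bornology.IsBounded G)
    (π ν : MeasureTheory.Measure G)
    [MeasureTheory.IsProbabilityMeasure π] [MeasureTheory.IsProbabilityMeasure ν]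
    (K : ProbabilityTheory.Kernel G G) [ProbabilityTheory.IsMarkovKernel K]
    (hK : K.IsReversible π) (hvb : MCQMC.IsVarianceBounding K π hK)
    (hν : MCQMC.HasL2Density ν π)
    (φ : G → MCQMC.Cube s → G) (hφ : MCQMC.IsUpdateFunction φ K)
    (ψ : MCQMC.Cube s → G) (hψ : MCQMC.IsGeneratorFunction ψ ν)
    (Λ₀ : ℝ) (hΛ₀ : Λ₀ = max (MCQMC.spectralSup K π hK) 0) :
    (∀ n : ℕ, 16 ≤ n → ∃ u : Fin n → MCQMC.Cube s,
      MCQMC.starDiscrepancy (MCQMC.anchoredBoxes G) π (MCQMC.drivenPoints φ ψ u) ≤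
        √((1 + Λ₀) / (1 - Λ₀)) *
          (√2 * √(Real.log (MCQMC.densityNorm ν π) + d * Real.log n
            + 3 * (d : ℝ) ^ 2 * Real.log (5 * d)) / √n)
        + 8 / (n : ℝ) ^ (3 / 4 : ℝ)) ∧
    ∃ u : (n : ℕ) → Fin n → MCQMC.Cube s,
      (fun n : ℕ =>
        MCQMC.starDiscrepancy (MCQMC.anchoredBoxes G) π (MCQMC.drivenPoints φ ψ (u n)))
        =O[Filter.atTop]
      (fun n : ℕ => (n : ℝ) ^ (-(1 / 2) : ℝ) * (Real.log n) ^ (1 / 2 : ℝ)) := by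
  have hgeneral := mainTheorem2_general hd G π ν K hK hvb hν φ hφ ψ hψ Λ₀ hΛ₀
  have hnonneg : 0 ≤ Λ₀ := hΛ₀ ▸ le_max_right _ _
  have hgap : 0 ≤ 1 - Λ₀ := sub_nonneg.2 (hΛ₀ ▸ (max_lt hvb one_pos).le)
  exact ⟨fun n hn => (hgeneral.1 n (by omega)).imp fun u hu => hu.trans (by gcongr; linarith),
    hgeneral.2⟩
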